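/- **Conventions.** All spaces are over $\mathbb C$. For a locally convex space $E$, $E^\star$ is the space of continuous linear functionals with the topology of uniform convergence on totally bounded sets. $E$ is *stereotype* if it is Hausdorff and the natural map $E\to E^{\star\star}$ is an isomorphism of topological vector spaces. A *stereotype algebra* is a unital associative algebra $A$ on a stereotype space such that for every compact $K\subseteq A$ and every neighbourhood of zero $U$ there is a neighbourhood of zero $V$ with $K\cdot V\subseteq U$ and $V\cdot K\subseteq U$; it is *involutive* if it carries a continuous conjugate-linear involution with $(ab)^*=b^*a^*$. A (left, unital) *stereotype module* over $A$ is an $A$-module $X$ on a stereotype space such that for every neighbourhood of zero $U\subseteq X$ and all compact $K\subseteq A$, $L\subseteq X$ there are neighbourhoods of zero $V\subseteq X$, $V'\subseteq A$ with $K\cdot V\subseteq U$ and $V'\cdot L\subseteq U$. $\operatorname{Spec}(A)$ is the set of continuous unital $*$-homomorphisms $t:A\to\mathbb C$ with the topology of uniform convergence on totally bounded subsets of $A$; $I_t=\ker t$, and $I_t\cdot X$ is the set of finite sums $\sum a_ix_i$, $a_i\in I_t$, $x_i\in X$. A space is pseudocomplete if every totally bounded Cauchy net in it converges; the pseudocompletion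 $E^\triangledown$ of a Hausdorff $E$ is the smallest pseudocomplete vector subspace of its completion that contains $E$, with the subspace topology. A *locally convex bundle* over a topological space $M$ is a surjection $\pi:\Xi\to M$ whose fibres are vector spaces, with a topology on $\Xi$ and a system $\mathcal P$ of functions $\Xi\to[0,\infty)$ such that: $\pi$ is continuous and open; (a) on each fibre the functions in $\mathcal P$ are seminorms defining a Hausdorff locally convex topology, which is the one induced from $\Xi$; (b) scalar multiplication $\mathbb C\times\Xi\to\Xi$ and (c) fibrewise addition $\Xi\times_M\Xi\to\Xi$ are continuous; (d) every $p\in\mathcal P$ is upper semicontinuous; (e) for every $t\in M$ and every neighbourhood $V$ of the zero $0_t$ of the fibre over $t$ there are $p\in\mathcal P$, $\varepsilon>0$ and an open $U\ni t$ with $\{\xi\in\pi^{-1}(U):p(\xi)<\varepsilon\}\subseteq V$. $\operatorname{Sec}(\pi)$ is the $C(M)$-module of continuous sections with the topology of uniform convergence on compact sets, i.e. given by the seminorms $p_T(s)=\sup_{t\in T}p(s(t))$, $p\in\mathcal P$, $T\subseteq M$ compact. **Theorem.** Let $X$ be a stereotype module over an involutive stereotype algebra $A$. Let $M=\operatorname{Spec}(A)$,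 $$J^0_AX=\bigsqcup_{t\in M}\bigl(X/\overline{I_t\cdot X}\bigr)^\triangledown ,$$ let $\pi^0:J^0_AX\to M$ be the projection, and put $j^0(x)(t)=x+\overline{I_t\cdot X}$. For each continuous seminorm $p$ on $X$ let $p^0$ be the function on $J^0_AX$ whose restriction to each fibre is the continuous extension of the quotient seminorm $p^0(x+\overline{I_t\cdot X})=\inf_{y\in\overline{I_t\cdot X}}p(x+y)$. Then there is exactly one topology on $J^0_AX$ for which $\pi^0$ is a locally convex bundle with the system of seminorms $\{p^0\}$, all the sections $j^0(x)$, $x\in X$, are continuous, and $j^0:X\to\operatorname{Sec}(\pi^0)$ is continuous. This topology induces on each fibre its topology of a pseudocompletion; with the action $(a\cdot s)(t)=t(a)\,s(t)$ the space $\operatorname{Sec}(\pi^0)$ is a locally convex $A$-module with jointly continuous action, and $j^0$ is a homomorphism of $A$-modules. Moreover: (i) the sets $W(x,U,p,\varepsilon)=\{\xi\in J^0_AX:\ \pi^0(\xi)\in U,\ p^0\bigl(\xi-j^0(x)(\pi^0(\xi))\bigr)<\varepsilon\}$, where $x\in X$, $p$ is a continuous seminorm on $X$, $\varepsilon>0$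 and $U\subseteq M$ is open, form a base of this topology; (ii) if $\operatorname{Spec}(A)$ is paracompact and locally compact, then $j^0$ has dense image in $\operatorname{Sec}(\pi^0)$. -/

import Mathlib

open Topology

universe u v w

namespace StereotypeBundle

noncomputable section

/-! ### Stereotype spaces, algebras and modules -/

/-- The space of continuous linear functionals on `E` with the topology of uniform convergence on
totally bounded sets. -/
abbrev StereotypeDual (E : Type u) [AddCommGroup E] [Module ℂ E] [UniformSpace E] : Type u :=
  UniformConvergenceCLM (E := E) (RingHom.id ℂ) ℂ {S : Set E | TotallyBounded S}

theorem continuous_dual_apply {E : Type u} [AddCommGroup E] [Module ℂ E] [UniformSpace E] (x : E) :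
    Continuous fun f : StereotypeDual E => f x :=
  (UniformConvergenceCLM.continuousEvalConst (RingHom.id ℂ) (E := E) ℂ {S : Set E | TotallyBounded S}
    (Set.eq_univ_of_forall fun y =>
      ⟨{y}, Set.finite_singleton y |>.totallyBounded, rfl⟩)).continuous_eval_const x

/-- The natural map of `E` into its second dual, `x ↦ (f ↦ f x)`. -/
def evalBidual (E : Type u) [AddCommGroup E] [Module ℂ E] [UniformSpace E] (x : E) :
    StereotypeDual (StereotypeDual E) :=
  UniformConvergenceCLM.ofFun (RingHom.id ℂ) ℂ _
    { toFun := fun f => f x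
      map_add' := fun _ _ => rfl
      map_smul' := fun _ _ => rfl
      cont := continuous_dual_apply x }

/-- A stereotype space: a Hausdorff locally convex space over `ℂ` such that the natural map into
the second dual is an isomorphism of topological vector spaces. -/
structure IsStereotypeSpace (E : Type u) [AddCommGroup E] [Module ℂ E] [UniformSpace E]
    [IsUniformAddGroup E] [ContinuousSMul ℂ E] : Prop where
  t2 : T2Space E
  locallyConvex : LocallyConvexSpace ℝ E
  reflexive : IsHomeomorph (evalBidual E)

/-- A (unital, associative) stereotype algebra: a stereotype space with a multiplication such that
for each compact set `K` and each neighbourhood of zero `U` there is a neighbourhood of zero `V`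
with `K · V ⊆ U` and `V · K ⊆ U`. -/
structure IsStereotypeAlgebra (A : Type u) [Ring A] [Algebra ℂ A] [UniformSpace A]
    [IsUniformAddGroup A] [ContinuousSMul ℂ A] : Prop where
  space : IsStereotypeSpace A
  mul_left : ∀ K : Set A, IsCompact K → ∀ U ∈ 𝓝 (0 : A), ∃ V ∈ 𝓝 (0 : A),
    ∀ a ∈ K, ∀ b ∈ V, a * b ∈ U
  mul_right : ∀ K : Set A, IsCompact K → ∀ U ∈ 𝓝 (0 : A), ∃ V ∈ 𝓝 (0 : A),
    ∀ a ∈ V, ∀ b ∈ K, a * b ∈ U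

/-- A (left, unital) stereotype module over `A`. -/
structure IsStereotypeModule (A : Type u) (X : Type v) [Ring A] [Algebra ℂ A] [UniformSpace A]
    [AddCommGroup X] [Module ℂ X] [Module A X] [IsScalarTower ℂ A X] [UniformSpace X]
    [IsUniformAddGroup X] [ContinuousSMul ℂ X] : Prop where
  space : IsStereotypeSpace X
  smul_left : ∀ K : Set A, IsCompact K → ∀ U ∈ 𝓝 (0 : X), ∃ V ∈ 𝓝 (0 : X),
    ∀ a ∈ K, ∀ x ∈ V, a • x ∈ U
  smul_right : ∀ K : Set X, IsCompact K → ∀ U ∈ 𝓝 (0 : X), ∃ V ∈ 𝓝 (0 : A),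
    ∀ a ∈ V, ∀ x ∈ K, a • x ∈ U

/-! ### The involutive spectrum -/

/-- The involutive spectrum of `A`: the continuous unital `*`-homomorphisms `A → ℂ`. -/
def Spec (A : Type u) [Ring A] [Algebra ℂ A] [StarRing A] [UniformSpace A] : Type u :=
  {t : A →⋆ₐ[ℂ] ℂ // Continuous t}

section Spectrum

variable {A : Type u} [Ring A] [Algebra ℂ A] [StarRing A] [UniformSpace A]

instance : CoeFun (Spec A) (fun _ => A → ℂ) := ⟨fun t => t.1⟩

/-- A character as an element of the dual space. -/
def Spec.toDual (t : Spec A) : StereotypeDual A :=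
  UniformConvergenceCLM.ofFun (RingHom.id ℂ) ℂ _
    { toFun := t
      map_add' := map_add t.1
      map_smul' := map_smul t.1
      cont := t.2 }

/-- The topology of uniform convergence on totally bounded subsets of `A`. -/
instance : TopologicalSpace (Spec A) := TopologicalSpace.induced Spec.toDual inferInstance

theorem Spec.continuous_apply (a : A) : Continuous fun t : Spec A => t a :=
  (continuous_dual_apply a).comp (continuous_induced_dom (f := Spec.toDual (A := A)))

/-- The map `σ : A → C(Spec A)`, `σ(a)(t) = t(a)`. -/
def gelfand (a : A) : C(Spec A, ℂ) := ⟨fun t => t a, Spec.continuous_apply a⟩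

end Spectrum

/-! ### Pseudocompletion -/

/-- Every totally bounded Cauchy net converges. -/
def IsPseudocomplete (E : Type u) [UniformSpace E] : Prop :=
  ∀ S : Set E, TotallyBounded S → ∀ f : Filter E, Cauchy f → S ∈ f → ∃ x, f ≤ 𝓝 x

section Pseudocompletion

variable (E : Type u) [AddCommGroup E] [Module ℂ E] [UniformSpace E] [IsUniformAddGroup E]
  [UniformContinuousConstSMul ℂ E]

/-- The pseudocompletion of `E`: the smallest pseudocomplete vector subspace of the completion of
`E` that contains (the image of) `E`, with the topology of a subspace. -/
def pseudocompletion : Submodule ℂ (UniformSpace.Completion E) :=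
  sInf {S | (∀ x : E, (x : UniformSpace.Completion E) ∈ S) ∧ IsPseudocomplete S}

variable {E}

theorem coe_mem_pseudocompletion (x : E) :
    (x : UniformSpace.Completion E) ∈ pseudocompletion E :=
  Submodule.mem_sInf.2 fun _ hS => hS.1 x

/-- The continuous extension of a continuous seminorm to the completion. -/
def completionSeminorm (q : Seminorm ℂ E) (hq : Continuous q) :
    Seminorm ℂ (UniformSpace.Completion E) :=
  have hu : UniformContinuous q :=
    Seminorm.uniformContinuous_of_continuousAt_zero (hq.continuousAt)
  have hc : Continuous (UniformSpace.Completion.extension (q : E → ℝ)) :=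
    UniformSpace.Completion.continuous_extension
  Seminorm.of (UniformSpace.Completion.extension (q : E → ℝ))
    (fun x y => by
      induction x, y using UniformSpace.Completion.induction_on₂ with
      | hp =>
        exact isClosed_le (hc.comp (continuous_fst.add continuous_snd))
          ((hc.comp continuous_fst).add (hc.comp continuous_snd))
      | ih a b =>
        rw [← UniformSpace.Completion.coe_add, UniformSpace.Completion.extension_coe hu,
          UniformSpace.Completion.extension_coe hu, UniformSpace.Completion.extension_coe hu]
        exact map_add_le_add q a b)
    (fun c x => by
      induction x using UniformSpace.Completion.induction_on with
      | hp =>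
        exact isClosed_eq (hc.comp (continuous_const_smul c)) (continuous_const.mul hc)
      | ih a =>
        rw [← UniformSpace.Completion.coe_smul, UniformSpace.Completion.extension_coe hu,
          UniformSpace.Completion.extension_coe hu]
        exact map_smul_eq_mul q c a)

theorem completionSeminorm_coe (q : Seminorm ℂ E) (hq : Continuous q) (x : E) :
    completionSeminorm q hq (x : UniformSpace.Completion E) = q x :=
  UniformSpace.Completion.extension_coe
    (Seminorm.uniformContinuous_of_continuousAt_zero (hq.continuousAt)) x

end Pseudocompletion

/-! ### Quotients -/

section Quotient

variable {X : Type v} [AddCommGroup X] [Module ℂ X] [UniformSpace X] [IsUniformAddGroup X]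

/-- The uniform structure of the quotient topological vector space. -/
instance instUniformSpaceQuotient (N : Submodule ℂ X) : UniformSpace (X ⧸ N) :=
  IsTopologicalAddGroup.rightUniformSpace (X ⧸ N)

instance instIsUniformAddGroupQuotient (N : Submodule ℂ X) : IsUniformAddGroup (X ⧸ N) :=
  isUniformAddGroup_of_addCommGroup

instance instUniformContinuousConstSMulQuotient [ContinuousSMul ℂ X] (N : Submodule ℂ X) :
    UniformContinuousConstSMul ℂ (X ⧸ N) :=
  uniformContinuousConstSMul_of_continuousConstSMul ℂ (X ⧸ N)

/-- The quotient seminorm `x + N ↦ inf_{y ∈ N} p (x + y)`. -/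
def quotientSeminorm (p : Seminorm ℂ X) (N : Submodule ℂ X) : Seminorm ℂ (X ⧸ N) :=
  have hb : ∀ ξ : X ⧸ N, BddBelow (Set.range fun x : {x : X // N.mkQ x = ξ} => p x.1) :=
    fun ξ => ⟨0, by rintro _ ⟨x, rfl⟩; exact apply_nonneg p _⟩
  have hn : ∀ ξ : X ⧸ N, Nonempty {x : X // N.mkQ x = ξ} := fun ξ => by
    obtain ⟨x, hx⟩ := N.mkQ_surjective ξ
    exact ⟨⟨x, hx⟩⟩
  Seminorm.ofSMulLE (fun ξ => ⨅ x : {x : X // N.mkQ x = ξ}, p x.1)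
    (le_antisymm
      ((ciInf_le (hb 0) ⟨0, map_zero _⟩).trans_eq (map_zero p))
      (Real.iInf_nonneg fun x => apply_nonneg p _))
    (fun ξ η => by
      have := hn ξ
      have := hn η
      refine le_ciInf_add_ciInf fun x y => ?_
      refine (ciInf_le (hb (ξ + η)) ⟨x.1 + y.1, ?_⟩).trans (map_add_le_add p _ _)
      rw [map_add, x.2, y.2])
    (fun c ξ => by
      have := hn ξ
      rw [Real.mul_iInf_of_nonneg (norm_nonneg c)]
      refine le_ciInf fun x => ?_
      refine (ciInf_le (hb (c • ξ)) ⟨c • x.1, ?_⟩).trans_eq (map_smul_eq_mul p c _)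
      rw [map_smul, x.2])

theorem quotientSeminorm_mk (p : Seminorm ℂ X) (N : Submodule ℂ X) (x : X) :
    quotientSeminorm p N (N.mkQ x) = ⨅ y : N, p (x + y) := by
  let e : N ≃ {z : X // N.mkQ z = N.mkQ x} :=
    { toFun := fun y => ⟨x + y, by simp⟩
      invFun := fun z => ⟨z.1 - x, by
        have := z.2
        simpa [Submodule.Quotient.eq] using this⟩
      left_inv := fun y => by simp
      right_inv := fun z => Subtype.ext (by simp) }
  exact (e.iInf_comp (g := fun z => p z.1)).symm

theorem continuous_quotientSeminorm {p : Seminorm ℂ X} (hp : Continuous p) (N : Submodule ℂ X) :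
    Continuous (quotientSeminorm p N) := by
  refine Seminorm.continuous_of_continuousAt_zero ?_
  rw [ContinuousAt, map_zero, ← map_zero N.mkQ]
  have hq : IsOpenQuotientMap (N.mkQ : X → X ⧸ N) := N.isOpenQuotientMap_mkQ
  rw [← hq.isOpenMap.map_nhds_eq hq.continuous.continuousAt, Filter.tendsto_map'_iff]
  refine squeeze_zero (g := p) (fun x => apply_nonneg _ _) (fun x => ?_) ?_
  · rw [Function.comp_apply, quotientSeminorm_mk]
    refine (ciInf_le ⟨0, ?_⟩ (0 : N)).trans_eq (by simp)
    rintro _ ⟨y, rfl⟩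
    exact apply_nonneg p _
  · simpa using hp.tendsto 0

end Quotient

/-! ### Locally convex bundles -/

/-- The total space of a family of vector spaces (the disjoint union of the fibres). -/
structure TotalSpace {M : Type u} (E : M → Type v) where
  proj : M
  val : E proj

/-- The family of vector spaces `E`, with a topology on the total space and with the system of
functions `P` on the total space (given as families of fibrewise seminorms), is a bundle of locally
convex spaces over `M`. -/
structure IsLocallyConvexBundle {M : Type u} [TopologicalSpace M] {E : M → Type v}
    [∀ t, AddCommGroup (E t)] [∀ t, Module ℂ (E t)] [TopologicalSpace (TotalSpace E)]
    {ι : Type w} (P : ι → ∀ t, Seminorm ℂ (E t)) : Prop where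
  continuous_proj : Continuous (TotalSpace.proj : TotalSpace E → M)
  isOpenMap_proj : IsOpenMap (TotalSpace.proj : TotalSpace E → M)
  /-- the seminorms define the topology induced on each fibre -/
  withSeminorms : ∀ t, WithSeminorms (topology := .induced (TotalSpace.mk t) inferInstance)
    (fun i => P i t : SeminormFamily ℂ (E t) ι)
  /-- the fibres are Hausdorff -/
  separating : ∀ t, ∀ v : E t, v ≠ 0 → ∃ i, P i t v ≠ 0
  continuous_smul : Continuous fun z : ℂ × TotalSpace E =>
    (⟨z.2.proj, z.1 • z.2.val⟩ : TotalSpace E)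
  /-- fibrewise addition is continuous on the fibre product of the total space with itself, which
  is the subspace of the product formed by the pairs lying over one point -/
  continuous_add : Continuous[.induced
      (fun z : TotalSpace (fun t => E t × E t) =>
        ((⟨z.proj, z.val.1⟩, ⟨z.proj, z.val.2⟩) : TotalSpace E × TotalSpace E)) inferInstance, _]
    fun z : TotalSpace (fun t => E t × E t) => (⟨z.proj, z.val.1 + z.val.2⟩ : TotalSpace E)
  upperSemicontinuous : ∀ i, UpperSemicontinuous fun ξ : TotalSpace E => P i ξ.proj ξ.val
  exists_subset_of_mem_nhds : ∀ t, ∀ V ∈ 𝓝 (⟨t, 0⟩ : TotalSpace E), ∃ i, ∃ ε > 0, ∃ U : Set M,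
    IsOpen U ∧ t ∈ U ∧ {ξ : TotalSpace E | ξ.proj ∈ U ∧ P i ξ.proj ξ.val < ε} ⊆ V

section Sections

variable {M : Type u} [TopologicalSpace M] {E : M → Type v} [∀ t, AddCommGroup (E t)]
  [∀ t, Module ℂ (E t)] [TopologicalSpace (TotalSpace E)] {ι : Type w}
  {P : ι → ∀ t, Seminorm ℂ (E t)}

theorem IsLocallyConvexBundle.continuous_section_add (h : IsLocallyConvexBundle P)
    {s s' : ∀ t, E t} (hs : Continuous fun t => (⟨t, s t⟩ : TotalSpace E))
    (hs' : Continuous fun t => (⟨t, s' t⟩ : TotalSpace E)) :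
    Continuous fun t => (⟨t, s t + s' t⟩ : TotalSpace E) := by
  let : TopologicalSpace (TotalSpace fun t => E t × E t) := .induced
    (fun z : TotalSpace (fun t => E t × E t) =>
      ((⟨z.proj, z.val.1⟩, ⟨z.proj, z.val.2⟩) : TotalSpace E × TotalSpace E)) inferInstance
  have hc : Continuous fun t => (⟨t, (s t, s' t)⟩ : TotalSpace fun t => E t × E t) :=
    continuous_induced_rng.2 (hs.prodMk hs')
  exact Continuous.comp h.continuous_add hc

theorem IsLocallyConvexBundle.continuous_section_smul (h : IsLocallyConvexBundle P)
    {s : ∀ t, E t} (hs : Continuous fun t => (⟨t, s t⟩ : TotalSpace E)) {a : M → ℂ}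
    (ha : Continuous a) : Continuous fun t => (⟨t, a t • s t⟩ : TotalSpace E) :=
  h.continuous_smul.comp (ha.prodMk hs)

theorem IsLocallyConvexBundle.continuous_section_zero (h : IsLocallyConvexBundle P) :
    Continuous fun t => (⟨t, 0⟩ : TotalSpace E) := by
  refine continuous_iff_continuousAt.2 fun t => Filter.tendsto_def.2 fun V hV => ?_
  obtain ⟨i, ε, hε, U, hU, htU, hUV⟩ := h.exists_subset_of_mem_nhds t V hV
  filter_upwards [hU.mem_nhds htU] with s hs
  exact hUV ⟨hs, by simpa using hε⟩

/-- The continuous sections of a locally convex bundle, as a vector space. -/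
def sectionSubmodule (h : IsLocallyConvexBundle P) : Submodule ℂ (∀ t, E t) where
  carrier := {s | Continuous fun t => (⟨t, s t⟩ : TotalSpace E)}
  add_mem' := h.continuous_section_add
  zero_mem' := h.continuous_section_zero
  smul_mem' _ _ hs := h.continuous_section_smul hs continuous_const

/-- The space of continuous sections of a locally convex bundle. -/
def Sec (h : IsLocallyConvexBundle P) : Type (max u v) := sectionSubmodule h

instance (h : IsLocallyConvexBundle P) : AddCommGroup (Sec h) :=
  inferInstanceAs (AddCommGroup (sectionSubmodule h))

instance (h : IsLocallyConvexBundle P) : Module ℂ (Sec h) :=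
  inferInstanceAs (Module ℂ (sectionSubmodule h))

instance (h : IsLocallyConvexBundle P) : CoeFun (Sec h) (fun _ => ∀ t, E t) := ⟨fun s => s.1⟩

/-- The space of continuous sections is a module over the algebra of continuous functions on the
base. -/
instance (h : IsLocallyConvexBundle P) : Module C(M, ℂ) (Sec h) where
  smul a s := ⟨fun t => a t • s t, h.continuous_section_smul s.2 a.continuous⟩
  one_smul s := Subtype.ext (funext fun t => one_smul ℂ (s t))
  mul_smul a b s := Subtype.ext (funext fun t => mul_smul (a t) (b t) (s t))
  smul_zero a := Subtype.ext (funext fun t => smul_zero (a t))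
  smul_add a s s' := Subtype.ext (funext fun t => smul_add (a t) (s t) (s' t))
  add_smul a b s := Subtype.ext (funext fun t => add_smul (a t) (b t) (s t))
  zero_smul s := Subtype.ext (funext fun t => zero_smul ℂ (s t))

theorem IsLocallyConvexBundle.bddAbove (h : IsLocallyConvexBundle P) (i : ι)
    (T : TopologicalSpace.Compacts M) (s : Sec h) :
    BddAbove (Set.range fun t : T => P i t (s t)) := by
  have hu : UpperSemicontinuous fun t => P i t (s t) := (h.upperSemicontinuous i).comp s.2
  have := (hu.upperSemicontinuousOn (T : Set M)).bddAbove_of_isCompact T.isCompact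
  rwa [Set.image_eq_range] at this

/-- The seminorm `p_T (s) = sup_{t ∈ T} p (s t)` on the space of continuous sections. -/
def secSeminorm (h : IsLocallyConvexBundle P) :
    SeminormFamily ℂ (Sec h) (ι × TopologicalSpace.Compacts M) := fun q =>
  Seminorm.of (fun s : Sec h => ⨆ t : q.2, P q.1 t (s t))
    (fun s s' => Real.iSup_le (fun t => (map_add_le_add (P q.1 t) (s t) (s' t)).trans
        (add_le_add (le_ciSup (h.bddAbove q.1 q.2 s) t) (le_ciSup (h.bddAbove q.1 q.2 s') t)))
      (add_nonneg (Real.iSup_nonneg fun _ => apply_nonneg _ _)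
        (Real.iSup_nonneg fun _ => apply_nonneg _ _)))
    (fun c s => by
      rw [Real.mul_iSup_of_nonneg (norm_nonneg c)]
      exact iSup_congr fun t => map_smul_eq_mul (P q.1 t) c (s t))

/-- The topology of uniform convergence on compact subsets of the base, that is, the locally convex
topology defined by the seminorms `p_T`. -/
instance (h : IsLocallyConvexBundle P) : TopologicalSpace (Sec h) :=
  (secSeminorm h).moduleFilterBasis.topology

end Sections

/-! ### The value bundle of a module -/

section ValueBundle

variable {A : Type u} {X : Type v} [Ring A] [Algebra ℂ A] [StarRing A] [UniformSpace A]
  [AddCommGroup X] [Module ℂ X] [Module A X] [UniformSpace X]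
  [IsUniformAddGroup X] [ContinuousSMul ℂ X]

variable (X) in
/-- The closure of `I_t · X`, where `I_t` is the kernel of `t`, and `I_t · X` consists of the finite
sums of elements `a • x` with `a ∈ I_t`, `x ∈ X`. -/
def closedKerSMul (t : Spec A) : Submodule ℂ X :=
  (Submodule.span ℂ {y : X | ∃ a : A, t a = 0 ∧ ∃ x : X, a • x = y}).topologicalClosure

variable (X) in
/-- The stereotype quotient of `X` by the closure of `I_t · X`: the pseudocompletion of the usual
quotient space. -/
abbrev Fiber (t : Spec A) : Type v := pseudocompletion (X ⧸ closedKerSMul X t)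

/-- The value `j⁰(x)(t)`, i.e. the class of `x` modulo the closure of `I_t · X`. -/
def jet (x : X) (t : Spec A) : Fiber X t :=
  ⟨(((closedKerSMul X t).mkQ x : X ⧸ closedKerSMul X t) : UniformSpace.Completion _),
    coe_mem_pseudocompletion _⟩

variable (A X) in
/-- The disjoint union of the stereotype quotients. -/
abbrev ValueSpace : Type (max u v) := TotalSpace fun t : Spec A => Fiber X t

/-- The seminorm `p⁰` on the fibre over `t`: the continuous extension of the quotient seminorm. -/
def fiberSeminorm (p : {p : Seminorm ℂ X // Continuous p}) (t : Spec A) :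
    Seminorm ℂ (Fiber X t) :=
  (completionSeminorm (quotientSeminorm p.1 (closedKerSMul X t))
    (continuous_quotientSeminorm p.2 _)).comp (pseudocompletion _).subtype

theorem fiberSeminorm_jet (p : {p : Seminorm ℂ X // Continuous p}) (t : Spec A) (x : X) :
    fiberSeminorm p t (jet x t) = ⨅ y : closedKerSMul X t, p.1 (x + y) :=
  (completionSeminorm_coe (quotientSeminorm p.1 (closedKerSMul X t))
    (continuous_quotientSeminorm p.2 _) _).trans (quotientSeminorm_mk p.1 _ x)

variable (A X) in
/-- The system of functions `p⁰`, indexed by all continuous seminorms `p` on `X`. -/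
abbrev valueSeminorms (p : {p : Seminorm ℂ X // Continuous p}) (t : Spec A) :
    Seminorm ℂ (Fiber X t) := fiberSeminorm p t

/-- The map `j⁰ : X → Sec(π⁰)`, for a topology on the disjoint union that makes it a locally convex
bundle and all the sections `j⁰(x)` continuous. -/
def jetMap [TopologicalSpace (ValueSpace A X)] (h : IsLocallyConvexBundle (valueSeminorms A X))
    (hj : ∀ x : X, Continuous fun t : Spec A => (⟨t, jet x t⟩ : ValueSpace A X)) :
    X →ₗ[ℂ] Sec h where
  toFun x := ⟨fun t => jet x t, hj x⟩
  map_add' x y := Subtype.ext <| funext fun t => Subtype.ext <| by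
    change (((closedKerSMul X t).mkQ (x + y) : X ⧸ closedKerSMul X t) :
      UniformSpace.Completion (X ⧸ closedKerSMul X t)) = _
    rw [map_add, UniformSpace.Completion.coe_add]
    rfl
  map_smul' c x := Subtype.ext <| funext fun t => Subtype.ext <| by
    change (((closedKerSMul X t).mkQ (c • x) : X ⧸ closedKerSMul X t) :
      UniformSpace.Completion (X ⧸ closedKerSMul X t)) = _
    rw [map_smul, UniformSpace.Completion.coe_smul]
    rfl

/-- The set `W(x, U, p, ε)`. -/
def basicSet (x : X) (U : Set (Spec A)) (p : {p : Seminorm ℂ X // Continuous p}) (ε : ℝ) :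
    Set (ValueSpace A X) :=
  {ξ | ξ.proj ∈ U ∧ fiberSeminorm p ξ.proj (ξ.val - jet x ξ.proj) < ε}

end ValueBundle

end

end StereotypeBundle

open StereotypeBundle

/-! The bundle is governed by its jets. Suppose a directed, separating system of seminorms and a
linear family of sections `j x` are given, with values dense in each fibre and each `t ↦ p (j x t)`
upper semicontinuous. Then the tubes around these sections form a base: by density a point of two
tubes is approximated by some `j y`, and semicontinuity spreads the strict inequality at one `t` to
a neighbourhood. The same approximation by sections yields the bundle axioms. Conversely, in any
bundle where the `j x` are continuous, tubes are open, and continuity of addition at `(0_t, v)`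
carries the tube neighbourhoods of zero to tubes near `v`. So the tubes are again a base, and the
topology is unique.

For the jets the real content is semicontinuity (`upperSemicontinuous_fiberSeminorm_jet`). An
element `∑ aᵢ • xᵢ` of `I_t · X` moves continuously to `∑ (aᵢ - s(aᵢ)) • xᵢ ∈ I_s · X`, so a
representative that is nearly minimal at `t` remains good for nearby `s`.

Joint continuity of the action comes from reflexivity of `A`, which makes compact sets of characters
equicontinuous. Density of the image comes from a partition of unity on a compact set, whose
functions are approximated by elements of `A` via Stone–Weierstrass. -/

namespace StereotypeBundle

noncomputable section

open Filter

/-! ### Bundles generated by a family of sections -/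

section Tubes

variable {M : Type u} {E : M → Type v} [∀ t, AddCommGroup (E t)]
  [∀ t, Module ℂ (E t)] {ι : Type w} {X : Type*} [AddCommGroup X] [Module ℂ X]

/-- The set of all `ξ` over `U` whose distance to the section `j x` is less than `ε` with respect
to the `i`-th seminorm. -/
def tube (P : ι → ∀ t, Seminorm ℂ (E t)) (j : X →ₗ[ℂ] ∀ t, E t) (x : X) (U : Set M) (i : ι)
    (ε : ℝ) : Set (TotalSpace E) :=
  {ξ | ξ.proj ∈ U ∧ P i ξ.proj (ξ.val - j x ξ.proj) < ε}

variable [TopologicalSpace M]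

/-- The collection of all tubes around the sections `j x` over open sets. -/
def tubes (P : ι → ∀ t, Seminorm ℂ (E t)) (j : X →ₗ[ℂ] ∀ t, E t) : Set (Set (TotalSpace E)) :=
  {W | ∃ (x : X) (U : Set M) (i : ι) (ε : ℝ), IsOpen U ∧ 0 < ε ∧ W = tube P j x U i ε}

/-- A directed separating system of seminorms and a fibrewise dense linear family of sections on
which the seminorms are upper semicontinuous. -/
structure IsFundamentalFamily (P : ι → ∀ t, Seminorm ℂ (E t)) (j : X →ₗ[ℂ] ∀ t, E t) : Prop where
  nonempty : Nonempty ι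
  directed : ∀ i k, ∃ l, ∀ t, P i t ≤ P l t ∧ P k t ≤ P l t
  separating : ∀ t, ∀ v : E t, v ≠ 0 → ∃ i, P i t v ≠ 0
  upperSemicontinuous : ∀ i x, UpperSemicontinuous fun t => P i t (j x t)
  dense : ∀ i t v, ∀ ε > 0, ∃ x, P i t (v - j x t) < ε

variable {P : ι → ∀ t, Seminorm ℂ (E t)} {j : X →ₗ[ℂ] ∀ t, E t}

omit [TopologicalSpace M] in
-- The distance from `ξ` to `j x` is at most `ε - 2δ` and that to `j y` is below `δ`. The remaining
-- margin `δ` is the radius of the new tube around `j y`.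
theorem seminorm_section_sub_lt {ξ : TotalSpace E} {x y : X} {i l : ι}
    {ε δ : ℝ} (hil : ∀ s, P i s ≤ P l s) (hle : 2 * δ ≤ ε - P i ξ.proj (ξ.val - j x ξ.proj))
    (hy : P l ξ.proj (ξ.val - j y ξ.proj) < δ) : P i ξ.proj (j (y - x) ξ.proj) < ε - δ := by
  have h1 : j (y - x) ξ.proj = (ξ.val - j x ξ.proj) - (ξ.val - j y ξ.proj) := by
    rw [map_sub, Pi.sub_apply]; abel
  have h2 := map_sub_le_add (P i ξ.proj) (ξ.val - j x ξ.proj) (ξ.val - j y ξ.proj)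
  have h3 := hil ξ.proj (ξ.val - j y ξ.proj)
  rw [h1]
  linarith

namespace IsFundamentalFamily

/-- The distance between the two sections stays below `ε - δ` near `t` by semicontinuity; adding the
radius `δ` gives at most `ε`. -/
theorem exists_tube_subset (H : IsFundamentalFamily P j) {x y : X} {U : Set M} {i l : ι}
    {ε δ : ℝ} (hU : IsOpen U) {t : M} (ht : t ∈ U) (hil : ∀ s, P i s ≤ P l s)
    (hlt : P i t (j (y - x) t) < ε - δ) :
    ∃ U', IsOpen U' ∧ t ∈ U' ∧ tube P j y U' l δ ⊆ tube P j x U i ε := by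
  refine ⟨U ∩ {s | P i s (j (y - x) s) < ε - δ},
    hU.inter ((H.upperSemicontinuous i (y - x)).isOpen_preimage _), ⟨ht, hlt⟩, ?_⟩
  rintro ⟨s, v⟩ ⟨⟨hsU, hs⟩, hv⟩
  refine ⟨hsU, ?_⟩
  have h1 : v - j x s = (v - j y s) + j (y - x) s := by
    rw [map_sub, Pi.sub_apply]; abel
  have h2 := map_add_le_add (P i s) (v - j y s) (j (y - x) s)
  have h3 := hil s (v - j y s)
  change P l s (v - j y s) < δ at hv
  change P i s (j (y - x) s) < ε - δ at hs
  change P i s (v - j x s) < ε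
  rw [h1]
  linarith

/-- The tubes form a base of a topology. -/
theorem isTopologicalBasis_generateFrom (H : IsFundamentalFamily P j) :
    TopologicalSpace.IsTopologicalBasis (t := .generateFrom (tubes P j)) (tubes P j) := by
  let _ : TopologicalSpace (TotalSpace E) := .generateFrom (tubes P j)
  refine ⟨?_, ?_, rfl⟩
  · rintro _ ⟨x₁, U₁, i₁, ε₁, hU₁, -, rfl⟩ _ ⟨x₂, U₂, i₂, ε₂, hU₂, -, rfl⟩ ξ ⟨h₁, h₂⟩
    obtain ⟨l, hl⟩ := H.directed i₁ i₂
    have hg₁ := sub_pos.2 h₁.2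
    have hg₂ := sub_pos.2 h₂.2
    obtain ⟨δ, hδ, hδ₁, hδ₂⟩ : ∃ δ > 0, 2 * δ ≤ ε₁ - P i₁ ξ.proj (ξ.val - j x₁ ξ.proj) ∧
        2 * δ ≤ ε₂ - P i₂ ξ.proj (ξ.val - j x₂ ξ.proj) :=
      ⟨_, half_pos (lt_min hg₁ hg₂),
        (mul_div_cancel₀ _ two_ne_zero).trans_le (min_le_left _ _),
        (mul_div_cancel₀ _ two_ne_zero).trans_le (min_le_right _ _)⟩
    obtain ⟨y, hy⟩ := H.dense l ξ.proj ξ.val δ hδ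
    obtain ⟨V₁, hV₁, hξ₁, hs₁⟩ := H.exists_tube_subset hU₁ h₁.1 (fun s => (hl s).1)
      (seminorm_section_sub_lt (fun s => (hl s).1) hδ₁ hy)
    obtain ⟨V₂, hV₂, hξ₂, hs₂⟩ := H.exists_tube_subset hU₂ h₂.1 (fun s => (hl s).2)
      (seminorm_section_sub_lt (fun s => (hl s).2) hδ₂ hy)
    exact ⟨_, ⟨y, V₁ ∩ V₂, l, δ, hV₁.inter hV₂, hδ, rfl⟩, ⟨⟨hξ₁, hξ₂⟩, hy⟩,
      fun ζ hζ => ⟨hs₁ ⟨hζ.1.1, hζ.2⟩, hs₂ ⟨hζ.1.2, hζ.2⟩⟩⟩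
  · refine Set.eq_univ_of_forall fun ξ => ?_
    obtain ⟨i⟩ := H.nonempty
    obtain ⟨y, hy⟩ := H.dense i ξ.proj ξ.val 1 one_pos
    exact ⟨_, ⟨y, Set.univ, i, 1, isOpen_univ, one_pos, rfl⟩, Set.mem_univ _, hy⟩

end IsFundamentalFamily

/-! ### Bundle axioms for a topology that has the tubes as a base. -/

variable [TopologicalSpace (TotalSpace E)]

theorem tendsto_of_isTopologicalBasis_tubes
    (hb : TopologicalSpace.IsTopologicalBasis (tubes P j)) {α : Type*} {f : α → TotalSpace E}
    {F : Filter α} {ξ : TotalSpace E} (hproj : Tendsto (fun a => (f a).proj) F (𝓝 ξ.proj))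
    (hf : ∀ x i ε, P i ξ.proj (ξ.val - j x ξ.proj) < ε →
      ∀ᶠ a in F, P i (f a).proj ((f a).val - j x (f a).proj) < ε) : Tendsto f F (𝓝 ξ) := by
  refine hb.nhds_hasBasis.tendsto_right_iff.2 ?_
  rintro _ ⟨⟨x, U, i, ε, hU, -, rfl⟩, hξ⟩
  filter_upwards [hproj.eventually (hU.mem_nhds hξ.1), hf x i ε hξ.2] with a h1 h2
  exact ⟨h1, h2⟩

theorem eventually_of_isTopologicalBasis_tubes
    (hb : TopologicalSpace.IsTopologicalBasis (tubes P j)) {ξ : TotalSpace E} {x : X} {i : ι}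
    {ε : ℝ} (h : P i ξ.proj (ξ.val - j x ξ.proj) < ε) :
    ∀ᶠ ζ in 𝓝 ξ, P i ζ.proj (ζ.val - j x ζ.proj) < ε := by
  have hε : 0 < ε := (apply_nonneg _ _).trans_lt h
  filter_upwards [(hb.isOpen ⟨x, Set.univ, i, ε, isOpen_univ, hε, rfl⟩).mem_nhds
    (⟨Set.mem_univ _, h⟩ : ξ ∈ tube P j x Set.univ i ε)] with ζ hζ using hζ.2

theorem isOpenMap_proj_of_tubes (hb : TopologicalSpace.IsTopologicalBasis (tubes P j)) :
    IsOpenMap (TotalSpace.proj : TotalSpace E → M) := by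
  refine hb.isOpenMap_iff.2 ?_
  rintro _ ⟨x, U, i, ε, hU, hε, rfl⟩
  convert hU
  ext t
  refine ⟨?_, fun ht => ⟨⟨t, j x t⟩, ⟨ht, by simpa using hε⟩, rfl⟩⟩
  rintro ⟨ζ, hζ, rfl⟩
  exact hζ.1

theorem upperSemicontinuous_seminorm_of_tubes
    (hb : TopologicalSpace.IsTopologicalBasis (tubes P j)) (i : ι) :
    UpperSemicontinuous fun ξ : TotalSpace E => P i ξ.proj ξ.val := by
  intro ξ c hc
  have := eventually_of_isTopologicalBasis_tubes hb (ξ := ξ) (x := 0) (i := i) (ε := c)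
    (by simpa using hc)
  simpa using this

namespace IsFundamentalFamily

theorem continuous_proj (H : IsFundamentalFamily P j)
    (hb : TopologicalSpace.IsTopologicalBasis (tubes P j)) :
    Continuous (TotalSpace.proj : TotalSpace E → M) := by
  obtain ⟨i⟩ := H.nonempty
  refine continuous_iff_continuousAt.2 fun ξ => tendsto_nhds.2 fun U hU hξ => ?_
  obtain ⟨y, hy⟩ := H.dense i ξ.proj ξ.val 1 one_pos
  refine mem_of_superset ((hb.isOpen ⟨y, U, i, 1, hU, one_pos, rfl⟩).mem_nhds ?_)
    fun ζ (hζ : ζ ∈ tube P j y U i 1) => hζ.1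
  exact ⟨hξ, hy⟩

theorem eventually_section_lt (H : IsFundamentalFamily P j)
    (hb : TopologicalSpace.IsTopologicalBasis (tubes P j)) {ξ : TotalSpace E} {x : X} {i : ι}
    {ε : ℝ} (h : P i ξ.proj (j x ξ.proj) < ε) :
    ∀ᶠ ζ : TotalSpace E in 𝓝 ξ, P i ζ.proj (j x ζ.proj) < ε :=
  (H.continuous_proj hb).continuousAt.eventually (H.upperSemicontinuous i x _ _ h)

theorem continuous_section (H : IsFundamentalFamily P j)
    (hb : TopologicalSpace.IsTopologicalBasis (tubes P j)) (x : X) :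
    Continuous fun t => (⟨t, j x t⟩ : TotalSpace E) := by
  refine continuous_iff_continuousAt.2 fun t =>
    tendsto_of_isTopologicalBasis_tubes hb tendsto_id fun y i ε h => ?_
  have := H.upperSemicontinuous i (x - y) t ε (by simpa using h)
  simpa using this

theorem continuous_smul (H : IsFundamentalFamily P j)
    (hb : TopologicalSpace.IsTopologicalBasis (tubes P j)) :
    Continuous fun z : ℂ × TotalSpace E => (⟨z.2.proj, z.1 • z.2.val⟩ : TotalSpace E) := by
  refine continuous_iff_continuousAt.2 fun ⟨c, ξ⟩ =>
    tendsto_of_isTopologicalBasis_tubes hb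
      (((H.continuous_proj hb).comp continuous_snd).tendsto _) fun x i ε h => ?_
  simp only at h ⊢
  set g := ε - P i ξ.proj (c • ξ.val - j x ξ.proj) with hg
  have hg0 : 0 < g := sub_pos.2 h
  -- The gap `g` is shared out through `b • v - j x = b • (v - j y) + (b - c) • j y + j (c • y -
  -- x)`: a quarter for each of the first two terms, with `‖b‖ < ‖c‖ + 1` near `c`, while the last
  -- stays below `ε - g / 2`.
  have hc1 : 0 < ‖c‖ + 1 := by positivity
  obtain ⟨y, hy⟩ := H.dense i ξ.proj ξ.val (g / 4 / (‖c‖ + 1)) (by positivity)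
  -- Adding 1 leaves room for `C` to bound the seminorm of `j y` on a whole neighbourhood.
  set C := P i ξ.proj (j y ξ.proj) + 1 with hC
  have hC0 : 0 < C := by positivity
  have hyx : P i ξ.proj (j (c • y - x) ξ.proj) < ε - g / 2 := by
    have e : j (c • y - x) ξ.proj
        = (c • ξ.val - j x ξ.proj) - c • (ξ.val - j y ξ.proj) := by
      simp only [map_sub, map_smul, Pi.sub_apply, Pi.smul_apply, smul_sub]; abel
    have h1 := map_sub_le_add (P i ξ.proj) (c • ξ.val - j x ξ.proj) (c • (ξ.val - j y ξ.proj))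
    rw [map_smul_eq_mul, ← e] at h1
    have h2 : ‖c‖ * P i ξ.proj (ξ.val - j y ξ.proj) ≤ g / 4 := by
      have := (lt_div_iff₀ hc1).1 hy
      nlinarith [apply_nonneg (P i ξ.proj) (ξ.val - j y ξ.proj)]
    linarith
  have ev1 : ∀ᶠ b : ℂ in 𝓝 c, ‖b‖ < ‖c‖ + 1 :=
    (continuous_norm.tendsto c).eventually (gt_mem_nhds (lt_add_one _))
  have ev2 : ∀ᶠ b : ℂ in 𝓝 c, ‖b - c‖ < g / 4 / C := by
    have : Tendsto (fun b : ℂ => ‖b - c‖) (𝓝 c) (𝓝 0) := by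
      have := (continuous_id.sub (continuous_const (y := c))).norm.tendsto c
      simpa using this
    exact this.eventually (gt_mem_nhds (by positivity))
  rw [nhds_prod_eq]
  filter_upwards [(ev1.and ev2).prod_mk ((eventually_of_isTopologicalBasis_tubes hb hy).and
    ((H.eventually_section_lt hb (lt_add_one (P i ξ.proj (j y ξ.proj)))).and (H.eventually_section_lt hb hyx)))]
  rintro ⟨b, s, v⟩ ⟨⟨hb1, hb2⟩, hv1, hv2, hv3⟩
  simp only at hb1 hb2 hv1 hv2 hv3 ⊢
  have e : b • v - j x s = b • (v - j y s) + ((b - c) • j y s + j (c • y - x) s) := by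
    simp only [map_sub, map_smul, Pi.sub_apply, Pi.smul_apply, smul_sub, sub_smul]; abel
  have h1 := map_add_le_add (P i s) (b • (v - j y s)) ((b - c) • j y s + j (c • y - x) s)
  have h2 := map_add_le_add (P i s) ((b - c) • j y s) (j (c • y - x) s)
  rw [map_smul_eq_mul] at h1 h2
  have h3 : ‖b‖ * P i s (v - j y s) ≤ g / 4 := by
    rw [lt_div_iff₀ hc1] at hv1
    nlinarith [apply_nonneg (P i s) (v - j y s)]
  have h4 : ‖b - c‖ * P i s (j y s) ≤ g / 4 := by
    rw [lt_div_iff₀ hC0] at hb2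
    nlinarith [norm_nonneg (b - c)]
  rw [e]
  linarith

theorem continuous_add (H : IsFundamentalFamily P j)
    (hb : TopologicalSpace.IsTopologicalBasis (tubes P j)) :
    Continuous[.induced
      (fun z : TotalSpace (fun t => E t × E t) =>
        ((⟨z.proj, z.val.1⟩, ⟨z.proj, z.val.2⟩) : TotalSpace E × TotalSpace E)) inferInstance, _]
    fun z : TotalSpace (fun t => E t × E t) => (⟨z.proj, z.val.1 + z.val.2⟩ : TotalSpace E) := by
  let _ : TopologicalSpace (TotalSpace fun t => E t × E t) := .induced
    (fun z : TotalSpace (fun t => E t × E t) =>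
      ((⟨z.proj, z.val.1⟩, ⟨z.proj, z.val.2⟩) : TotalSpace E × TotalSpace E)) inferInstance
  have hi : Continuous (fun z : TotalSpace (fun t => E t × E t) =>
      ((⟨z.proj, z.val.1⟩, ⟨z.proj, z.val.2⟩) : TotalSpace E × TotalSpace E)) :=
    continuous_induced_dom
  have hi₁ := continuous_fst.comp hi
  have hi₂ := continuous_snd.comp hi
  refine continuous_iff_continuousAt.2 fun ⟨t, ξ, η⟩ =>
    tendsto_of_isTopologicalBasis_tubes hb (((H.continuous_proj hb).comp hi₁).tendsto _)
      fun x i ε h => ?_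
  simp only at h ⊢
  set g := ε - P i t (ξ + η - j x t) with hg
  have hg0 : 0 < g := sub_pos.2 h
  obtain ⟨y, hy⟩ := H.dense i t ξ (g / 4) (by positivity)
  obtain ⟨z, hz⟩ := H.dense i t η (g / 4) (by positivity)
  have hyx : P i t (j (y + z - x) t) < ε - g / 2 := by
    have e : j (y + z - x) t = (ξ + η - j x t) - ((ξ - j y t) + (η - j z t)) := by
      simp only [map_sub, map_add, Pi.sub_apply, Pi.add_apply]; abel
    have h1 := map_sub_le_add (P i t) (ξ + η - j x t) ((ξ - j y t) + (η - j z t))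
    have h2 := map_add_le_add (P i t) (ξ - j y t) (η - j z t)
    rw [e]
    linarith
  have ev1 := (hi₁.tendsto ⟨t, ξ, η⟩).eventually (eventually_of_isTopologicalBasis_tubes hb
    (ξ := ⟨t, ξ⟩) hy)
  have ev2 := (hi₂.tendsto ⟨t, ξ, η⟩).eventually (eventually_of_isTopologicalBasis_tubes hb
    (ξ := ⟨t, η⟩) hz)
  have ev3 := (hi₁.tendsto ⟨t, ξ, η⟩).eventually (H.eventually_section_lt hb (ξ := ⟨t, ξ⟩) hyx)
  filter_upwards [ev1, ev2, ev3]
  rintro ⟨s, v, w⟩ h1 h2 h3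
  simp only [Function.comp_apply] at h1 h2 h3 ⊢
  have e : v + w - j x s = ((v - j y s) + (w - j z s)) + j (y + z - x) s := by
    simp only [map_sub, map_add, Pi.sub_apply, Pi.add_apply]; abel
  have h4 := map_add_le_add (P i s) ((v - j y s) + (w - j z s)) (j (y + z - x) s)
  have h5 := map_add_le_add (P i s) (v - j y s) (w - j z s)
  rw [e]
  linarith

omit [TopologicalSpace (TotalSpace E)] in
theorem exists_le_of_finset (H : IsFundamentalFamily P j) (s : Finset ι) :
    ∃ l, ∀ i ∈ s, ∀ t, P i t ≤ P l t := by
  classical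
  induction s using Finset.induction_on with
  | empty =>
    obtain ⟨i⟩ := H.nonempty
    exact ⟨i, by simp⟩
  | insert a s _ ih =>
    obtain ⟨k, hk⟩ := ih
    obtain ⟨l, hl⟩ := H.directed a k
    refine ⟨l, fun i hi t => ?_⟩
    obtain rfl | hi := Finset.mem_insert.1 hi
    · exact (hl t).1
    · exact (hk i hi t).trans (hl t).2

/-- Tubes are centred only at values of sections, so a ball of radius `r` about `v` is reached by a
tube of radius `r / 2` about a value within `r / 2` of `v`. -/
theorem induced_mk_eq (H : IsFundamentalFamily P j)
    (hb : TopologicalSpace.IsTopologicalBasis (tubes P j)) (t : M) :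
    TopologicalSpace.induced (TotalSpace.mk t) inferInstance =
      (SeminormFamily.moduleFilterBasis
        (fun i => P i t : SeminormFamily ℂ (E t) ι)).topology := by
  let p : SeminormFamily ℂ (E t) ι := fun i => P i t
  let _ : TopologicalSpace (E t) := p.moduleFilterBasis.topology
  have hp : WithSeminorms p := ⟨rfl⟩
  have := hp.topologicalAddGroup
  refine le_antisymm ?_ (continuous_iff_le_induced.1 ?_)
  · refine le_of_nhds_le_nhds fun v U hU => ?_
    obtain ⟨s, r, hr, hs⟩ := (hp.mem_nhds_iff v U).1 hU
    obtain ⟨l, hl⟩ := H.exists_le_of_finset s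
    obtain ⟨x, hx⟩ := H.dense l t v (r / 2) (half_pos hr)
    rw [nhds_induced]
    refine ⟨tube P j x Set.univ l (r / 2), (hb.isOpen
      ⟨x, Set.univ, l, r / 2, isOpen_univ, half_pos hr, rfl⟩).mem_nhds ⟨trivial, hx⟩, ?_⟩
    rintro w ⟨-, hw⟩
    refine hs ?_
    rw [Seminorm.mem_ball]
    refine Seminorm.finset_sup_apply_lt hr fun i hi => (hl i hi t _).trans_lt ?_
    have e : w - v = (w - j x t) - (v - j x t) := by abel
    have h1 := map_sub_le_add (P l t) (w - j x t) (v - j x t)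
    rw [e]
    linarith
  · refine continuous_iff_continuousAt.2 fun v =>
      tendsto_of_isTopologicalBasis_tubes hb tendsto_const_nhds fun x i ε h => ?_
    have hc : Continuous fun w => P i t (w - j x t) :=
      (hp.continuous_seminorm i).comp (continuous_id.sub continuous_const)
    exact (hc.tendsto v).eventually (gt_mem_nhds h)

theorem exists_subset_of_mem_nhds (H : IsFundamentalFamily P j)
    (hb : TopologicalSpace.IsTopologicalBasis (tubes P j)) (t : M) (V : Set (TotalSpace E))
    (hV : V ∈ 𝓝 (⟨t, 0⟩ : TotalSpace E)) : ∃ i, ∃ ε > 0, ∃ U : Set M,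
    IsOpen U ∧ t ∈ U ∧ {ξ : TotalSpace E | ξ.proj ∈ U ∧ P i ξ.proj ξ.val < ε} ⊆ V := by
  obtain ⟨_, ⟨⟨x, U, i, ε, hU, -, rfl⟩, ht⟩, hW⟩ := hb.nhds_hasBasis.mem_iff.1 hV
  have h := ht.2
  simp only [zero_sub, map_neg_eq_map] at h
  -- The zero vector lies within `δ < ε` of `j x t`, so the tube of radius `ε - δ` about the zero
  -- section fits over a smaller base.
  obtain ⟨δ, hδ, hδε⟩ := exists_between h
  obtain ⟨U', hU', htU', hs⟩ := H.exists_tube_subset (x := x) (y := 0) (i := i) (l := i)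
    (ε := ε) (δ := ε - δ) hU ht.1 (fun _ => le_rfl) (by simpa using hδ)
  exact ⟨i, ε - δ, sub_pos.2 hδε, U', hU', htU', fun ζ hζ => hW (hs ⟨hζ.1, by simpa using hζ.2⟩)⟩

theorem isLocallyConvexBundle (H : IsFundamentalFamily P j)
    (hb : TopologicalSpace.IsTopologicalBasis (tubes P j)) : IsLocallyConvexBundle P where
  continuous_proj := H.continuous_proj hb
  isOpenMap_proj := isOpenMap_proj_of_tubes hb
  withSeminorms t := .mk (topology := _) (H.induced_mk_eq hb t)
  separating := H.separating
  continuous_smul := H.continuous_smul hb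
  continuous_add := H.continuous_add hb
  upperSemicontinuous := upperSemicontinuous_seminorm_of_tubes hb
  exists_subset_of_mem_nhds := H.exists_subset_of_mem_nhds hb

end IsFundamentalFamily

/-! ### Tubes in an arbitrary bundle, the source of uniqueness. -/

theorem IsLocallyConvexBundle.continuous_add_comp (h : IsLocallyConvexBundle P) {Y : Type*}
    [TopologicalSpace Y] {π : Y → M} {f g : ∀ y, E (π y)}
    (hf : Continuous fun y => (⟨π y, f y⟩ : TotalSpace E))
    (hg : Continuous fun y => (⟨π y, g y⟩ : TotalSpace E)) :
    Continuous fun y => (⟨π y, f y + g y⟩ : TotalSpace E) := by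
  let _ : TopologicalSpace (TotalSpace fun t => E t × E t) := .induced
    (fun z : TotalSpace (fun t => E t × E t) =>
      ((⟨z.proj, z.val.1⟩, ⟨z.proj, z.val.2⟩) : TotalSpace E × TotalSpace E)) inferInstance
  have hc : Continuous fun y => (⟨π y, (f y, g y)⟩ : TotalSpace fun t => E t × E t) :=
    continuous_induced_rng.2 (hf.prodMk hg)
  exact Continuous.comp h.continuous_add hc

/-- Fibrewise translation by a continuous section is continuous on the total space, and it turns the
tube into a sublevel set of an upper semicontinuous seminorm. -/
theorem IsLocallyConvexBundle.isOpen_tube (h : IsLocallyConvexBundle P)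
    (hj : ∀ x, Continuous fun t => (⟨t, j x t⟩ : TotalSpace E)) (x : X) {U : Set M}
    (hU : IsOpen U) (i : ι) (ε : ℝ) : IsOpen (tube P j x U i ε) := by
  have hc : Continuous fun ξ : TotalSpace E =>
      (⟨ξ.proj, ξ.val + j (-x) ξ.proj⟩ : TotalSpace E) :=
    h.continuous_add_comp (π := TotalSpace.proj) (f := TotalSpace.val) continuous_id
      ((hj (-x)).comp h.continuous_proj)
  have := (hU.preimage h.continuous_proj).inter
    (((h.upperSemicontinuous i).comp hc).isOpen_preimage ε)
  convert this using 1
  ext ξ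
  simp [tube, sub_eq_add_neg]

/-- In a locally convex bundle the tubes around a fibrewise dense family of continuous sections
form a base. -/
theorem IsLocallyConvexBundle.isTopologicalBasis_tubes (h : IsLocallyConvexBundle P)
    (hj : ∀ x, Continuous fun t => (⟨t, j x t⟩ : TotalSpace E)) (H : IsFundamentalFamily P j) :
    TopologicalSpace.IsTopologicalBasis (tubes P j) := by
  refine TopologicalSpace.isTopologicalBasis_of_isOpen_of_nhds ?_ ?_
  · rintro _ ⟨x, U, i, ε, hU, -, rfl⟩
    exact h.isOpen_tube hj x hU i ε
  rintro ⟨t, v⟩ V hv hV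
  let Z : Type _ := TotalSpace fun t => E t × E t
  let e : Z → TotalSpace E × TotalSpace E := fun z => (⟨z.proj, z.val.1⟩, ⟨z.proj, z.val.2⟩)
  let _ : TopologicalSpace Z := .induced e inferInstance
  have hadd : Continuous fun z : Z => (⟨z.proj, z.val.1 + z.val.2⟩ : TotalSpace E) :=
    h.continuous_add
  -- Axiom (e) describes neighbourhoods of zero vectors only; writing `v = 0 + v` makes it available
  -- at `v`.
  have hmem : (fun z : Z => (⟨z.proj, z.val.1 + z.val.2⟩ : TotalSpace E)) ⁻¹' V ∈
      𝓝 (⟨t, (0, v)⟩ : Z) :=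
    hadd.continuousAt.preimage_mem_nhds (hV.mem_nhds (by simpa using hv))
  rw [nhds_induced, mem_comap] at hmem
  obtain ⟨Q, hQ, hQV⟩ := hmem
  obtain ⟨O, O', hOo, hO, hO'o, hvO', hQ'⟩ := mem_nhds_prod_iff'.1 hQ
  obtain ⟨i, ε, hε, U, hU, htU, hUO⟩ := h.exists_subset_of_mem_nhds t O (hOo.mem_nhds hO)
  let p : SeminormFamily ℂ (E t) ι := fun i => P i t
  have hO't : (TotalSpace.mk t : E t → TotalSpace E) ⁻¹' O' ∈
      @nhds _ (.induced (TotalSpace.mk t) inferInstance) v := by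
    rw [nhds_induced]
    exact preimage_mem_comap (hO'o.mem_nhds hvO')
  obtain ⟨s, r, hr, hs⟩ := (@WithSeminorms.mem_nhds_iff ℂ (E t) ι _ _ _
    (.induced (TotalSpace.mk t) inferInstance) p (h.withSeminorms t) v _).1 hO't
  obtain ⟨k, hk⟩ := H.exists_le_of_finset s
  obtain ⟨l, hl⟩ := H.directed i k
  -- The bound `ε` puts `v` in the tube about `j x`; the bound `r` puts `j x t` in `O'`.
  obtain ⟨x, hx⟩ := H.dense l t v (min ε r) (lt_min hε hr)
  have hxO' : (⟨t, j x t⟩ : TotalSpace E) ∈ O' := by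
    refine hs ?_
    rw [Seminorm.mem_ball, map_sub_rev]
    exact Seminorm.finset_sup_apply_lt hr fun m hm =>
      ((hk m hm t).trans (hl t).2 _).trans_lt (hx.trans_le (min_le_right _ _))
  obtain ⟨U', hU'O, hU', htU'⟩ := mem_nhds_iff.1
    ((hj x).continuousAt.preimage_mem_nhds (hO'o.mem_nhds hxO'))
  refine ⟨_, ⟨x, U ∩ U', i, ε, hU.inter hU', hε, rfl⟩, ⟨⟨htU, htU'⟩,
    ((hl t).1 _).trans_lt (hx.trans_le (min_le_left _ _))⟩, ?_⟩
  rintro ⟨s, w⟩ ⟨⟨hsU, hsU'⟩, hw⟩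
  have hz : (⟨s, (w - j x s, j x s)⟩ : Z) ∈ e ⁻¹' Q := hQ' ⟨hUO ⟨hsU, hw⟩, hU'O hsU'⟩
  simpa using hQV hz

end Tubes

/-! ### Seminorms on quotients and completions -/

section Seminorms

open scoped ComplexOrder in
/-- The topology of a real or complex locally convex space is defined by all continuous
seminorms. -/
theorem withSeminorms_continuousSeminorms (𝕜 : Type w) [RCLike 𝕜] (E : Type u) [AddCommGroup E]
    [Module 𝕜 E] [Module ℝ E] [IsScalarTower ℝ 𝕜 E] [TopologicalSpace E]
    [IsTopologicalAddGroup E] [ContinuousSMul 𝕜 E] [ContinuousSMul ℝ E] [LocallyConvexSpace ℝ E] :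
    WithSeminorms fun p : {p : Seminorm 𝕜 E // Continuous p} => p.1 := by
  have : LocallyConvexSpace 𝕜 E :=
    ⟨by simpa only [convex_RCLike_iff_convex_real] using
      LocallyConvexSpace.convex_basis (𝕜 := ℝ) (E := E)⟩
  exact PolynormableSpace.withSeminorms 𝕜 E

/-- Closed neighbourhoods suffice. Since `E` is dense, an open seminorm ball of the completion lies
in the closure of its trace on `E`, hence in any closed set containing that trace. -/
theorem withSeminorms_completionSeminorm {E : Type u} [AddCommGroup E] [Module ℂ E]
    [UniformSpace E] [IsUniformAddGroup E] [UniformContinuousConstSMul ℂ E] {ι : Type w}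
    {q : SeminormFamily ℂ E ι} (hq : WithSeminorms q) (hc : ∀ i, Continuous (q i)) :
    WithSeminorms (fun i => completionSeminorm (q i) (hc i) :
      SeminormFamily ℂ (UniformSpace.Completion E) ι) := by
  have hcont : ∀ i, Continuous (completionSeminorm (q i) (hc i)) := fun i =>
    UniformSpace.Completion.continuous_extension
  refine (SeminormFamily.withSeminorms_iff_nhds_eq_iInf _).2 (le_antisymm ?_ ?_)
  · refine le_iInf fun i => tendsto_iff_comap.1 ?_
    simpa using (hcont i).tendsto 0
  · intro U hU
    obtain ⟨C, hC, hCc, hCU⟩ := exists_mem_nhds_isClosed_subset hU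
    have hC0 : ((↑) : E → UniformSpace.Completion E) ⁻¹' C ∈ 𝓝 (0 : E) :=
      (UniformSpace.Completion.continuous_coe E).continuousAt.preimage_mem_nhds
        (by rwa [UniformSpace.Completion.coe_zero])
    obtain ⟨s, r, hr, hs⟩ := (hq.mem_nhds_iff 0 _).1 hC0
    have hV : (⋂ i ∈ s, {ξ | completionSeminorm (q i) (hc i) ξ < r}) ∈
        ⨅ i, comap (completionSeminorm (q i) (hc i)) (𝓝 0) := by
      refine (biInter_finset_mem s).2 fun i _ => mem_iInf_of_mem i ?_
      exact ⟨_, Iio_mem_nhds hr, fun ξ hξ => hξ⟩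
    refine mem_of_superset hV fun ξ hξ => hCU ?_
    have hVo : IsOpen (⋂ i ∈ s, {ξ | completionSeminorm (q i) (hc i) ξ < r}) :=
      isOpen_biInter_finset fun i _ => isOpen_lt (hcont i) continuous_const
    rw [← hCc.closure_eq]
    refine closure_mono ?_ (UniformSpace.Completion.denseRange_coe.open_subset_closure_inter hVo hξ)
    rintro _ ⟨h, y, rfl⟩
    refine hs ?_
    rw [Seminorm.mem_ball, sub_zero]
    refine Seminorm.finset_sup_apply_lt hr fun i hi => ?_
    have := Set.mem_iInter₂.1 h i hi
    rwa [Set.mem_ofPred_eq, completionSeminorm_coe] at this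

variable {X : Type v} [AddCommGroup X] [Module ℂ X] [UniformSpace X] [IsUniformAddGroup X]

theorem withSeminorms_quotientSeminorm [ContinuousSMul ℂ X]
    (hX : WithSeminorms fun p : {p : Seminorm ℂ X // Continuous p} => p.1) (N : Submodule ℂ X) :
    WithSeminorms (fun p : {p : Seminorm ℂ X // Continuous p} => quotientSeminorm p.1 N) := by
  let P : SeminormFamily ℂ X {p : Seminorm ℂ X // Continuous p} := fun p => p.1
  refine (SeminormFamily.withSeminorms_iff_nhds_eq_iInf _).2 (le_antisymm ?_ ?_)
  · refine le_iInf fun p => tendsto_iff_comap.1 ?_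
    simpa using (continuous_quotientSeminorm p.2 N).tendsto 0
  · intro U hU
    have hU0 : N.mkQ ⁻¹' U ∈ 𝓝 (0 : X) :=
      N.isOpenQuotientMap_mkQ.continuous.continuousAt.preimage_mem_nhds (by rwa [map_zero])
    obtain ⟨s, r, hr, hs⟩ := (WithSeminorms.mem_nhds_iff (p := P) hX 0 _).1 hU0
    -- The finite supremum is itself an index of the family. Its quotient seminorm yields one
    -- representative small for all of `s`, which separate infima would not.
    have hc : Continuous (Finset.sup s P : Seminorm ℂ X) := Seminorm.continuous_finsetSup fun p _ => p.2
    refine mem_iInf_of_mem ⟨_, hc⟩ ⟨_, Iio_mem_nhds hr, fun ξ hξ => ?_⟩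
    have : Nonempty {x : X // N.mkQ x = ξ} := by
      obtain ⟨x, hx⟩ := N.mkQ_surjective ξ
      exact ⟨⟨x, hx⟩⟩
    obtain ⟨⟨x, rfl⟩, hx⟩ := exists_lt_of_ciInf_lt (show _ < r from hξ)
    exact hs (by simpa [Seminorm.mem_ball] using hx)

omit [UniformSpace X] [IsUniformAddGroup X] in
theorem quotientSeminorm_mono {p q : Seminorm ℂ X} (hpq : p ≤ q) (N : Submodule ℂ X) :
    quotientSeminorm p N ≤ quotientSeminorm q N := fun ξ =>
  ciInf_mono ⟨0, by rintro _ ⟨x, rfl⟩; exact apply_nonneg p _⟩ fun x => hpq x.1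

theorem completionSeminorm_mono {E : Type u} [AddCommGroup E] [Module ℂ E]
    [UniformSpace E] [IsUniformAddGroup E] [UniformContinuousConstSMul ℂ E] {p q : Seminorm ℂ E}
    (hp : Continuous p) (hq : Continuous q) (hpq : p ≤ q) :
    completionSeminorm p hp ≤ completionSeminorm q hq := by
  refine Seminorm.le_def.2 fun ξ => ?_
  refine UniformSpace.Completion.induction_on ξ (isClosed_le
    UniformSpace.Completion.continuous_extension UniformSpace.Completion.continuous_extension)
    fun a => ?_
  simpa only [completionSeminorm_coe] using hpq a

end Seminorms

/-! ### The jets form a fundamental family -/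

section Jets

variable {A : Type u} {X : Type v} [Ring A] [Algebra ℂ A] [StarRing A] [UniformSpace A]
  [AddCommGroup X] [Module ℂ X] [Module A X] [UniformSpace X]
  [IsUniformAddGroup X] [ContinuousSMul ℂ X]

variable (A X) in
/-- The map `j⁰` with values in all sections of the value bundle. -/
def jetLinear : X →ₗ[ℂ] ∀ t : Spec A, Fiber X t where
  toFun x t := jet x t
  map_add' x y := funext fun t => Subtype.ext <| by
    change (((closedKerSMul X t).mkQ (x + y) : X ⧸ closedKerSMul X t) :
      UniformSpace.Completion (X ⧸ closedKerSMul X t)) = _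
    rw [map_add, UniformSpace.Completion.coe_add]
    rfl
  map_smul' c x := funext fun t => Subtype.ext <| by
    change (((closedKerSMul X t).mkQ (c • x) : X ⧸ closedKerSMul X t) :
      UniformSpace.Completion (X ⧸ closedKerSMul X t)) = _
    rw [map_smul, UniformSpace.Completion.coe_smul]
    rfl

theorem fiberSeminorm_mono {p q : {p : Seminorm ℂ X // Continuous p}} (hpq : p.1 ≤ q.1)
    (t : Spec A) : fiberSeminorm p t ≤ fiberSeminorm q t := fun v =>
  completionSeminorm_mono (continuous_quotientSeminorm p.2 _) (continuous_quotientSeminorm q.2 _)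
    (quotientSeminorm_mono hpq _) v.1

theorem withSeminorms_fiberSeminorm
    (hX : WithSeminorms fun p : {p : Seminorm ℂ X // Continuous p} => p.1) (t : Spec A) :
    WithSeminorms (fun p : {p : Seminorm ℂ X // Continuous p} =>
      (fiberSeminorm p t : Seminorm ℂ (Fiber X t))) :=
  LinearMap.withSeminorms_induced
    (withSeminorms_completionSeminorm (withSeminorms_quotientSeminorm hX (closedKerSMul X t))
      fun p => continuous_quotientSeminorm p.2 _) (pseudocompletion _).subtype

theorem exists_fiberSeminorm_sub_jet_lt (p : {p : Seminorm ℂ X // Continuous p}) (t : Spec A)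
    (v : Fiber X t) {ε : ℝ} (hε : 0 < ε) : ∃ x : X, fiberSeminorm p t (v - jet x t) < ε := by
  let q := completionSeminorm (quotientSeminorm p.1 (closedKerSMul X t))
    (continuous_quotientSeminorm p.2 _)
  have hq : Continuous q := UniformSpace.Completion.continuous_extension
  obtain ⟨e, he⟩ := UniformSpace.Completion.denseRange_coe.exists_mem_open
    (isOpen_lt (hq.comp (continuous_const.sub continuous_id)) continuous_const :
      IsOpen {ζ | q (v.1 - ζ) < ε}) ⟨v.1, by simpa using hε⟩
  obtain ⟨x, rfl⟩ := (closedKerSMul X t).mkQ_surjective e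
  exact ⟨x, he⟩

theorem fiberSeminorm_jet_le (p : {p : Seminorm ℂ X // Continuous p}) (t : Spec A) (x : X) :
    fiberSeminorm p t (jet x t) ≤ p.1 x := by
  rw [fiberSeminorm_jet]
  refine (ciInf_le ⟨0, ?_⟩ 0).trans_eq (by simp)
  rintro _ ⟨y, rfl⟩
  exact apply_nonneg p.1 _

theorem apply_algebraMap_spec (t : Spec A) (c : ℂ) : t (algebraMap ℂ A c) = c :=
  AlgHomClass.commutes t.1 c

/-- For a generator `a • x` with `t a = 0`, the path is `s ↦ (a - s(a)) • x`: the coefficient lies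
in `I_s`, and at `s = t` the correction vanishes. -/
theorem exists_continuous_mem_span [IsScalarTower ℂ A X] (t : Spec A) {y : X}
    (hy : y ∈ Submodule.span ℂ {y : X | ∃ a : A, t a = 0 ∧ ∃ x : X, a • x = y}) :
    ∃ f : Spec A → X, Continuous f ∧ f t = y ∧ ∀ s, f s ∈ closedKerSMul X s := by
  induction hy using Submodule.span_induction with
  | mem y hy =>
    obtain ⟨a, ha, x, rfl⟩ := hy
    refine ⟨fun s => a • x - s a • x,
      continuous_const.sub ((Spec.continuous_apply a).smul continuous_const), by simp [ha],
      fun s => Submodule.le_topologicalClosure _ (Submodule.subset_span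
        ⟨a - algebraMap ℂ A (s a), ?_, x, ?_⟩)⟩
    · rw [map_sub, apply_algebraMap_spec, sub_self]
    · rw [sub_smul, algebraMap_smul]
  | zero => exact ⟨fun _ => 0, continuous_const, rfl, fun s => zero_mem _⟩
  | add y z _ _ hy hz =>
    obtain ⟨f, hf, rfl, hf'⟩ := hy
    obtain ⟨g, hg, rfl, hg'⟩ := hz
    exact ⟨fun s => f s + g s, hf.add hg, rfl, fun s => add_mem (hf' s) (hg' s)⟩
  | smul c y _ hy =>
    obtain ⟨f, hf, rfl, hf'⟩ := hy
    exact ⟨fun s => c • f s, hf.const_smul c, rfl, fun s => Submodule.smul_mem _ c (hf' s)⟩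

theorem upperSemicontinuous_fiberSeminorm_jet [IsScalarTower ℂ A X]
    (p : {p : Seminorm ℂ X // Continuous p}) (x : X) :
    UpperSemicontinuous fun t : Spec A => fiberSeminorm p t (jet x t) := by
  intro t c hc
  replace hc : fiberSeminorm p t (jet x t) < c := hc
  rw [fiberSeminorm_jet] at hc
  obtain ⟨⟨y, hy⟩, hyc⟩ := exists_lt_of_ciInf_lt hc
  -- Only finite sums can be moved along `s`, so `y` in the closure is replaced by an element of the
  -- span satisfying the same strict inequality.
  obtain ⟨z, hz, hzs⟩ := mem_closure_iff.1 hy {z | p.1 (x + z) < c}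
    (isOpen_lt (p.2.comp (continuous_const.add continuous_id)) continuous_const) hyc
  obtain ⟨f, hf, rfl, hfs⟩ := exists_continuous_mem_span t hzs
  have hev : ∀ᶠ s in 𝓝 t, p.1 (x + f s) < c :=
    ((p.2.comp (continuous_const.add hf)).tendsto t).eventually (gt_mem_nhds hz)
  filter_upwards [hev] with s hs
  change fiberSeminorm p s (jet x s) < c
  rw [fiberSeminorm_jet]
  refine (ciInf_le ⟨0, ?_⟩ (⟨f s, hfs s⟩ : closedKerSMul X s)).trans_lt hs
  rintro _ ⟨y, rfl⟩
  exact apply_nonneg p.1 _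

theorem isFundamentalFamily_jetLinear [IsScalarTower ℂ A X]
    (hX : WithSeminorms fun p : {p : Seminorm ℂ X // Continuous p} => p.1) :
    IsFundamentalFamily (valueSeminorms A X) (jetLinear A X) where
  nonempty := ⟨⟨0, continuous_const⟩⟩
  directed p q := ⟨⟨p.1 + q.1, p.2.add q.2⟩, fun t =>
    ⟨fiberSeminorm_mono (fun x => le_add_of_nonneg_right (apply_nonneg q.1 x)) t,
      fiberSeminorm_mono (fun x => le_add_of_nonneg_left (apply_nonneg p.1 x)) t⟩⟩
  separating t v hv := (withSeminorms_fiberSeminorm hX t).separating_of_T1 v hv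
  upperSemicontinuous := upperSemicontinuous_fiberSeminorm_jet
  dense p t v _ hε := exists_fiberSeminorm_sub_jet_lt p t v hε

theorem jet_smul [IsScalarTower ℂ A X] (a : A) (x : X) (t : Spec A) :
    jet (a • x) t = t a • jet x t := by
  have h : (closedKerSMul X t).mkQ (a • x) = t a • (closedKerSMul X t).mkQ x := by
    rw [← map_smul, Submodule.mkQ_apply, Submodule.mkQ_apply, Submodule.Quotient.eq]
    refine Submodule.le_topologicalClosure _ (Submodule.subset_span
      ⟨a - algebraMap ℂ A (t a), ?_, x, ?_⟩)
    · rw [map_sub, apply_algebraMap_spec, sub_self]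
    · rw [sub_smul, algebraMap_smul]
  refine Subtype.ext ?_
  change (((closedKerSMul X t).mkQ (a • x) : X ⧸ closedKerSMul X t) :
    UniformSpace.Completion (X ⧸ closedKerSMul X t)) = _
  rw [h, UniformSpace.Completion.coe_smul]
  rfl

end Jets

/-! ### Equicontinuity and Stone–Weierstrass on compact sets of characters. -/

section Spectrum

variable {A : Type u} [Ring A] [Algebra ℂ A] [StarRing A] [UniformSpace A]

instance : T2Space (Spec A) :=
  T2Space.of_injective_continuous (f := fun (t : Spec A) (a : A) => t a)
    (fun _ _ h => Subtype.ext (DFunLike.coe_injective h))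
    (continuous_pi fun a => Spec.continuous_apply a)

/-- A compact set of characters of a stereotype algebra is equicontinuous. -/
theorem eventually_forall_norm_apply_lt [IsUniformAddGroup A] [ContinuousSMul ℂ A]
    (hA : IsStereotypeSpace A) {T : Set (Spec A)} (hT : IsCompact T) {ε : ℝ} (hε : 0 < ε) :
    ∀ᶠ a in 𝓝 (0 : A), ∀ t ∈ T, ‖t a‖ < ε := by
  -- Being totally bounded in the dual, the image of `T` is one of the sets on which bidual
  -- convergence is uniform, so continuity of `evalBidual` at zero is the claim.
  have hK : TotallyBounded (Spec.toDual '' T) :=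
    (hT.image continuous_induced_dom).totallyBounded
  have h0 : evalBidual A 0 = 0 :=
    UniformConvergenceCLM.ext (RingHom.id ℂ) ℂ fun f => map_zero f
  have hc : Tendsto (evalBidual A) (𝓝 0) (𝓝 0) := by
    simpa only [h0] using hA.reflexive.continuous.tendsto 0
  filter_upwards [hc.eventually (UniformConvergenceCLM.eventually_nhds_zero_mapsTo
    (RingHom.id ℂ) hK (Metric.ball_mem_nhds (0 : ℂ) hε))] with a ha t ht
  exact mem_ball_zero_iff.1 (ha (Set.mem_image_of_mem _ ht))

/-- The restriction of the Gelfand transform to a set of characters. -/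
def gelfandRestrict (T : Set (Spec A)) : A →⋆ₐ[ℂ] C(T, ℂ) where
  toFun a := (gelfand a).restrict T
  map_one' := ContinuousMap.ext fun t => map_one t.1.1
  map_mul' a b := ContinuousMap.ext fun t => map_mul t.1.1 a b
  map_zero' := ContinuousMap.ext fun t => map_zero t.1.1
  map_add' a b := ContinuousMap.ext fun t => map_add t.1.1 a b
  commutes' c := ContinuousMap.ext fun t => AlgHomClass.commutes t.1.1 c
  map_star' a := ContinuousMap.ext fun t => map_star t.1.1 a

theorem exists_forall_norm_sub_apply_lt [StarModule ℂ A] {T : Set (Spec A)} (hT : IsCompact T)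
    (f : C(T, ℂ)) {ε : ℝ} (hε : 0 < ε) : ∃ a : A, ∀ t : T, ‖f t - t.1 a‖ < ε := by
  have := isCompact_iff_compactSpace.1 hT
  have hsep : (gelfandRestrict T).range.SeparatesPoints := by
    intro s t hst
    by_contra! h
    refine hst (Subtype.ext (Subtype.ext (DFunLike.ext _ _ fun a => ?_)))
    exact h _ ⟨_, ⟨a, rfl⟩, rfl⟩
  have hd := ContinuousMap.starSubalgebra_topologicalClosure_eq_top_of_separatesPoints _ hsep
  have hf : f ∈ closure ((gelfandRestrict T).range : Set C(T, ℂ)) := by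
    rw [← StarSubalgebra.topologicalClosure_coe, hd]
    trivial
  obtain ⟨_, ⟨a, rfl⟩, ha⟩ := Metric.mem_closure_iff.1 hf ε hε
  refine ⟨a, fun t => ?_⟩
  rw [← dist_eq_norm]
  exact (ContinuousMap.dist_apply_le_dist t).trans_lt ha

end Spectrum

/-! ### Estimates for the seminorms of the section space. -/

section Sections

variable {M : Type u} [TopologicalSpace M] {E : M → Type v} [∀ t, AddCommGroup (E t)]
  [∀ t, Module ℂ (E t)] [TopologicalSpace (TotalSpace E)] {ι : Type w}
  {P : ι → ∀ t, Seminorm ℂ (E t)}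

theorem withSeminorms_secSeminorm (h : IsLocallyConvexBundle P) :
    WithSeminorms (secSeminorm h) := ⟨rfl⟩

theorem le_secSeminorm (h : IsLocallyConvexBundle P) (i : ι) (T : TopologicalSpace.Compacts M)
    (s : Sec h) {t : M} (ht : t ∈ T) : P i t (s t) ≤ secSeminorm h (i, T) s :=
  le_ciSup (h.bddAbove i T s) (⟨t, ht⟩ : T)

theorem secSeminorm_le (h : IsLocallyConvexBundle P) {i : ι} {T : TopologicalSpace.Compacts M}
    {s : Sec h} {c : ℝ} (hc : 0 ≤ c) (hs : ∀ t ∈ T, P i t (s t) ≤ c) :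
    secSeminorm h (i, T) s ≤ c :=
  Real.iSup_le (fun t : T => hs t.1 t.2) hc

end Sections

/-! ### Continuity of the action, and continuity and density of the jets. -/

section Jets

variable {A : Type u} {X : Type v} [Ring A] [Algebra ℂ A] [StarRing A] [UniformSpace A]

/-- Over a stereotype algebra the sections of a bundle on the spectrum form a module with jointly
continuous action. -/
theorem continuous_gelfand_smul [IsUniformAddGroup A] [ContinuousSMul ℂ A]
    (hA : IsStereotypeSpace A) {E : Spec A → Type v}
    [∀ t, AddCommGroup (E t)] [∀ t, Module ℂ (E t)] [TopologicalSpace (TotalSpace E)]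
    {ι : Type w} {P : ι → ∀ t, Seminorm ℂ (E t)} (h : IsLocallyConvexBundle P) :
    Continuous fun z : A × Sec h => gelfand z.1 • z.2 := by
  have hp := withSeminorms_secSeminorm h
  have := hp.topologicalAddGroup
  refine continuous_iff_continuousAt.2 fun ⟨a, s⟩ => (hp.tendsto_nhds _ _).2 ?_
  rintro ⟨i, T⟩ ε hε
  obtain ⟨B, hB⟩ := T.isCompact.exists_bound_of_continuousOn (Spec.continuous_apply a).continuousOn
  set C := secSeminorm h (i, T) s with hC
  have hC0 : 0 ≤ C := apply_nonneg _ _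
  -- For `η ≤ 1`, `|B| + 1` bounds `‖t b‖` on `T` and `C` bounds `s`, so the total error is at most
  -- `η * D`.
  set D := |B| + 1 + C with hD
  have hD0 : 0 < D := by positivity
  obtain ⟨η, hη, hη1, hηD⟩ : ∃ η > 0, η ≤ 1 ∧ η * D < ε := by
    refine ⟨min 1 (ε / 2 / D), by positivity, min_le_left _ _, ?_⟩
    calc min 1 (ε / 2 / D) * D ≤ ε / 2 / D * D := by gcongr; exact min_le_right _ _
      _ = ε / 2 := div_mul_cancel₀ _ hD0.ne'
      _ < ε := half_lt_self hε
  have ev1 : ∀ᶠ b in 𝓝 a, ∀ t ∈ (T : Set (Spec A)), ‖t (b - a)‖ < η := by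
    have : Tendsto (fun b => b - a) (𝓝 a) (𝓝 0) := by
      have hc : Continuous fun b : A => b - a := continuous_id.sub continuous_const
      simpa using hc.tendsto a
    exact this.eventually (eventually_forall_norm_apply_lt hA T.isCompact hη)
  have ev2 : ∀ᶠ r in 𝓝 s, secSeminorm h (i, T) (r - s) < η :=
    (hp.tendsto_nhds id s).1 tendsto_id (i, T) η hη
  rw [nhds_prod_eq]
  filter_upwards [ev1.prod_mk ev2]
  rintro ⟨b, r⟩ ⟨hb, hr⟩
  simp only at hb hr ⊢
  refine (secSeminorm_le h (c := η * D) (by positivity) fun t ht => ?_).trans_lt hηD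
  change P i t (t b • r t - t a • s t) ≤ η * D
  have e : t b • r t - t a • s t = t b • (r t - s t) + t (b - a) • s t := by
    rw [map_sub, smul_sub, sub_smul]; abel
  have h1 := map_add_le_add (P i t) (t b • (r t - s t)) (t (b - a) • s t)
  rw [map_smul_eq_mul, map_smul_eq_mul] at h1
  have h2 : P i t (r t - s t) ≤ η := (le_secSeminorm h i T (r - s) ht).trans hr.le
  have h3 : P i t (s t) ≤ C := le_secSeminorm h i T s ht
  have h4 : ‖t b‖ ≤ |B| + 1 := by
    have e' : t b = t a + t (b - a) := by rw [map_sub]; abel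
    rw [e']
    exact (norm_add_le _ _).trans
      (add_le_add ((hB t ht).trans (le_abs_self B)) ((hb t ht).le.trans hη1))
  have h5 : ‖t b‖ * P i t (r t - s t) ≤ (|B| + 1) * η := by gcongr
  have h6 : ‖t (b - a)‖ * P i t (s t) ≤ η * C := by
    gcongr
    exact (hb t ht).le
  rw [e]
  linarith

variable [AddCommGroup X] [Module ℂ X] [Module A X] [UniformSpace X]
  [IsUniformAddGroup X] [ContinuousSMul ℂ X] [TopologicalSpace (ValueSpace A X)]

theorem continuous_jetMap (hX : WithSeminorms fun p : {p : Seminorm ℂ X // Continuous p} => p.1)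
    (h : IsLocallyConvexBundle (valueSeminorms A X))
    (hj : ∀ x : X, Continuous fun t : Spec A => (⟨t, jet x t⟩ : ValueSpace A X)) :
    Continuous (jetMap h hj) := by
  refine WithSeminorms.continuous_of_isBounded hX (withSeminorms_secSeminorm h) _ ?_
  rintro ⟨p, T⟩
  refine ⟨{p}, 1, fun x => ?_⟩
  rw [one_smul, Finset.sup_singleton]
  exact secSeminorm_le h (apply_nonneg _ _) fun t _ => fiberSeminorm_jet_le p t x

/-- On a compact set of characters every continuous section is uniformly approximated by jets. -/
theorem exists_forall_fiberSeminorm_sub_jet_le [StarModule ℂ A] [IsScalarTower ℂ A X]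
    (h : IsLocallyConvexBundle (valueSeminorms A X))
    (hj : ∀ x : X, Continuous fun t : Spec A => (⟨t, jet x t⟩ : ValueSpace A X))
    (s : Sec h) (p : {p : Seminorm ℂ X // Continuous p}) {T : Set (Spec A)} (hT : IsCompact T)
    {ε : ℝ} (hε : 0 < ε) : ∃ x : X, ∀ t ∈ T, fiberSeminorm p t (s t - jet x t) ≤ ε := by
  have := isCompact_iff_compactSpace.1 hT
  -- A jet close to `s` at one point stays close nearby, because the seminorm of the difference is
  -- upper semicontinuous; compactness leaves finitely many jets to glue.
  choose x hx using fun t : T => exists_fiberSeminorm_sub_jet_lt p t.1 (s t.1) (half_pos hε)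
  let V : T → Set T := fun t =>
    {r | fiberSeminorm p r.1 (s r.1 - jet (x t) r.1) < ε / 2}
  have hV : ∀ t, IsOpen (V t) := fun t => by
    have := (h.upperSemicontinuous p).comp (s - jetMap h hj (x t)).2
    exact (this.isOpen_preimage (ε / 2)).preimage continuous_subtype_val
  obtain ⟨F, hF⟩ := isCompact_univ.elim_finite_subcover V hV
    fun t _ => Set.mem_iUnion.2 ⟨t, hx t⟩
  obtain ⟨f, hf⟩ := PartitionOfUnity.exists_isSubordinate (isClosed_univ (X := T))
    (fun i : F => V i) (fun i => hV i) (by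
      intro r hr
      obtain ⟨i, hi, hri⟩ := Set.mem_iUnion₂.1 (hF hr)
      exact Set.mem_iUnion.2 ⟨⟨i, hi⟩, hri⟩)
  set C := ∑ i : F, p.1 (x i) with hC
  have hC0 : 0 ≤ C := Finset.sum_nonneg fun i _ => apply_nonneg _ _
  -- Replacing the partition functions by Gelfand transforms costs `δ * C ≤ ε / 2` in all.
  set δ := ε / 2 / (C + 1) with hδ
  have hδ0 : 0 < δ := by positivity
  have hδC : δ * C ≤ ε / 2 := by
    have : δ * (C + 1) = ε / 2 := div_mul_cancel₀ _ (by positivity)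
    nlinarith
  choose a ha using fun i : F => exists_forall_norm_sub_apply_lt hT
    (⟨fun r => (f i r : ℂ), by fun_prop⟩ : C(T, ℂ)) hδ0
  refine ⟨∑ i : F, a i • x i, fun t ht => ?_⟩
  let r : T := ⟨t, ht⟩
  have hsum : ∑ i : F, f i r = 1 := by
    rw [← finsum_eq_sum_of_fintype]
    exact f.sum_eq_one (Set.mem_univ r)
  have hjet : jet (∑ i : F, a i • x i) t = ∑ i : F, t (a i) • jet (x i) t := by
    have h1 := congrFun (map_sum (jetLinear A X) (fun i : F => a i • x i) Finset.univ) t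
    rw [Finset.sum_apply] at h1
    exact h1.trans (Finset.sum_congr rfl fun i _ => jet_smul (a i) (x i) t)
  have e : s t - jet (∑ i : F, a i • x i) t =
      ∑ i : F, ((f i r : ℂ) • (s t - jet (x i) t) + ((f i r : ℂ) - t (a i)) • jet (x i) t) := by
    have h2 : s t = ∑ i : F, (f i r : ℂ) • s t := by
      rw [← Finset.sum_smul, ← Complex.ofReal_sum, hsum, Complex.ofReal_one, one_smul]
    rw [hjet]
    nth_rewrite 1 [h2]
    rw [← Finset.sum_sub_distrib]
    refine Finset.sum_congr rfl fun i _ => ?_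
    rw [smul_sub, sub_smul]
    abel
  have hterm : ∀ i : F, fiberSeminorm p t ((f i r : ℂ) • (s t - jet (x i) t) +
      ((f i r : ℂ) - t (a i)) • jet (x i) t) ≤ f i r * (ε / 2) + δ * p.1 (x i) := by
    intro i
    refine (map_add_le_add _ _ _).trans (add_le_add ?_ ?_)
    · rw [map_smul_eq_mul, Complex.norm_real, Real.norm_of_nonneg (f.nonneg i r)]
      by_cases hi : r ∈ V i
      · exact mul_le_mul_of_nonneg_left (le_of_lt hi) (f.nonneg i r)
      · have : f i r = 0 := by
          by_contra h0
          exact hi (hf i (subset_tsupport _ h0))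
        simp [this]
    · rw [map_smul_eq_mul]
      exact mul_le_mul (ha i r).le (fiberSeminorm_jet_le p t (x i)) (apply_nonneg _ _) hδ0.le
  rw [e]
  calc _ ≤ ∑ i : F, (f i r * (ε / 2) + δ * p.1 (x i)) :=
        (Finset.le_sum_of_subadditive _ (map_zero _).le (map_add_le_add _) _ _).trans (Finset.sum_le_sum fun i _ => hterm i)
    _ = ε / 2 + δ * C := by
        rw [Finset.sum_add_distrib, ← Finset.sum_mul, hsum, one_mul, ← Finset.mul_sum]
    _ ≤ ε := by linarith

/-- A basic neighbourhood involves finitely many pairs `(i, T)`; one dominating seminorm and the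
union of the compact sets reduce it to a single uniform approximation. -/
theorem denseRange_jetMap [StarModule ℂ A] [IsScalarTower ℂ A X]
    (H : IsFundamentalFamily (valueSeminorms A X) (jetLinear A X))
    (h : IsLocallyConvexBundle (valueSeminorms A X))
    (hj : ∀ x : X, Continuous fun t : Spec A => (⟨t, jet x t⟩ : ValueSpace A X)) :
    DenseRange (jetMap h hj) := by
  classical
  intro s
  refine (mem_closure_iff_nhds_basis (withSeminorms_secSeminorm h).hasBasis_ball).2 ?_
  rintro ⟨F, r⟩ hr
  obtain ⟨p, hp⟩ := H.exists_le_of_finset (F.image Prod.fst)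
  obtain ⟨x, hx⟩ := exists_forall_fiberSeminorm_sub_jet_le h hj s p (F.sup Prod.snd).isCompact
    (half_pos hr)
  refine ⟨jetMap h hj x, ⟨x, rfl⟩, ?_⟩
  rw [Seminorm.mem_ball, map_sub_rev]
  refine Seminorm.finset_sup_apply_lt hr fun ⟨i, T⟩ hi =>
    (secSeminorm_le h (half_pos hr).le fun t ht => ?_).trans_lt (half_lt_self hr)
  exact (hp i (Finset.mem_image_of_mem _ hi) t _).trans
    (hx t (SetLike.le_def.1 (Finset.le_sup (f := Prod.snd) hi) ht))

end Jets

end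

end StereotypeBundle

theorem mainTheorem6 {A : Type u} {X : Type v}
    [Ring A] [Algebra ℂ A] [UniformSpace A] [IsUniformAddGroup A] [ContinuousSMul ℂ A]
    [StarRing A] [StarModule ℂ A] [ContinuousStar A]
    [AddCommGroup X] [Module ℂ X] [UniformSpace X] [IsUniformAddGroup X] [ContinuousSMul ℂ X]
    [Module A X] [IsScalarTower ℂ A X]
    (hA : IsStereotypeAlgebra A) (hX : IsStereotypeModule A X) :
    (∃! τ : TopologicalSpace (ValueSpace A X),
      ∃ (h : IsLocallyConvexBundle (valueSeminorms A X))
        (hj : ∀ x : X, Continuous fun t : Spec A =>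
          (⟨t, jet x t⟩ : ValueSpace A X)),
        Continuous (jetMap h hj)) ∧
    ∀ (τ : TopologicalSpace (ValueSpace A X))
      (h : IsLocallyConvexBundle (valueSeminorms A X))
      (hj : ∀ x : X, Continuous fun t : Spec A =>
        (⟨t, jet x t⟩ : ValueSpace A X)),
      (∀ t : Spec A, IsEmbedding
        (TotalSpace.mk t :
          Fiber X t → ValueSpace A X)) ∧
      (∀ (a : A) (x : X), jetMap h hj (a • x) =
        gelfand a • jetMap h hj x) ∧
      (Continuous fun z : A × Sec h => gelfand z.1 • z.2) ∧
      TopologicalSpace.IsTopologicalBasis {W : Set (ValueSpace A X) |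
        ∃ (x : X) (U : Set (Spec A)) (p : {p : Seminorm ℂ X // Continuous p})
          (ε : ℝ), IsOpen U ∧ 0 < ε ∧ W = basicSet x U p ε} ∧
      (ParacompactSpace (Spec A) → LocallyCompactSpace (Spec A) →
        DenseRange (jetMap h hj)) := by
  have := hX.space.locallyConvex
  have : ContinuousSMul ℝ X := IsScalarTower.continuousSMul ℂ
  have hs : WithSeminorms fun p : {p : Seminorm ℂ X // Continuous p} => p.1 :=
    withSeminorms_continuousSeminorms ℂ X
  have H : IsFundamentalFamily (valueSeminorms A X) (jetLinear A X) :=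
    isFundamentalFamily_jetLinear hs
  refine ⟨⟨.generateFrom (tubes (valueSeminorms A X) (jetLinear A X)), ?_, ?_⟩, ?_⟩
  · let _ : TopologicalSpace (ValueSpace A X) :=
      .generateFrom (tubes (valueSeminorms A X) (jetLinear A X))
    have hb := H.isTopologicalBasis_generateFrom
    exact ⟨H.isLocallyConvexBundle hb, H.continuous_section hb, continuous_jetMap hs _ _⟩
  · rintro τ ⟨h, hj, -⟩
    exact (h.isTopologicalBasis_tubes (j := jetLinear A X) hj H).eq_generateFrom
  · intro τ h hj
    refine ⟨fun t => ⟨⟨?_⟩, fun v w hvw => by cases hvw; rfl⟩,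
      fun a x => Subtype.ext (funext fun t => jet_smul a x t),
      continuous_gelfand_smul hA.space h,
      h.isTopologicalBasis_tubes (j := jetLinear A X) hj H,
      fun _ _ => denseRange_jetMap H h hj⟩
    -- The pseudocompletion topology and the one induced from the bundle are defined by the same
    -- seminorms.
    exact (withSeminorms_fiberSeminorm hs t).withSeminorms_eq.trans
      (@WithSeminorms.withSeminorms_eq _ _ _ _ _ _ _ (.induced _ _) (h.withSeminorms t)).symm
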